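/- Let $m,p,s,N\ge 1$ be integers with $s\le p$, and let $\sigma_a,\sigma,r>0$. Let $\mathcal D\subset\mathbb R^{m\times p}$ be the set of real $m\times p$ matrices (dictionaries) all of whose columns have Euclidean norm $1$, let $\mathbf D_0\in\mathcal D$ be a known reference dictionary, and put $$\mathcal X(\mathbf D_0,r)=\{\mathbf D\in\mathcal D:\ \|\mathbf D-\mathbf D_0\|_{\mathrm F}\le r\}.$$ For $\mathbf D\in\mathcal X(\mathbf D_0,r)$ let $\mathbf Y=(\mathbf y_1,\dots,\mathbf y_N)$ consist of $N$ i.i.d. copies of $\mathbf y=\mathbf D\mathbf x+\mathbf w$, where $\mathbf w\sim\mathcal N(\mathbf 0,\sigma^2\mathbf I)$ is independent of $\mathbf x\in\mathbb R^p$, and $\mathbf x$ is generated as follows: a set $\mathcal S\subseteq\{1,\dots,p\}$ is drawn uniformly at random among all subsets of size $s$, and given $\mathcal S$ the entries of $\mathbf x$ with index in $\mathcal S$ are i.i.d. $\mathcal N(0,\sigma_a^2)$ while all other entries are $0$. Let $\mathrm{SNR}=(\sigma_a/\sigma)^2$, and define the minimax risk $$\varepsilon=\inf_{\widehat{\mathbf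 D}}\ \sup_{\mathbf D\in\mathcal X(\mathbf D_0,r)}\ \mathrm E_{\mathbf Y}\big\{\|\widehat{\mathbf D}(\mathbf Y)-\mathbf D\|_{\mathrm F}^2\big\},$$ where the infimum is over all measurable maps $\widehat{\mathbf D}:\mathbb R^{m\times N}\to\mathbb R^{m\times p}$ (which may depend on all the parameters and on $\mathbf D_0$). If $r\le 1/\sqrt p$, $p>64$ and $m\ge 192\,s\,\big(9+2\log(p/s)\big)$, with $\log$ the natural logarithm, then $$\varepsilon\ \ge\ \min\left\{\frac{r^2}{16},\ \frac{\mathrm{SNR}^{-1}\,p^2}{5120\,N\,s}\right\}.$$ -/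

import Mathlib

open MeasureTheory ProbabilityTheory
open scoped ENNReal NNReal Matrix

noncomputable section

namespace DictLearning

/-- The Frobenius norm `‖A‖_F = √(tr (A Aᵀ))` of a real matrix. -/
def frobNorm {m n : ℕ} (A : Matrix (Fin m) (Fin n) ℝ) : ℝ :=
  Real.sqrt (A * Aᵀ).trace

/-- The oblique manifold: all real `m × p` matrices whose columns have Euclidean norm one. -/
def obliqueManifold (m p : ℕ) : Set (Matrix (Fin m) (Fin p) ℝ) :=
  {B | ∀ j : Fin p, ‖WithLp.toLp 2 (B.col j)‖ = 1}

/-- The dictionaries (matrices with unit-norm columns) within Frobenius distance `r` of the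
reference dictionary `D₀`. -/
def dictionaryBall {m p : ℕ} (D₀ : Matrix (Fin m) (Fin p) ℝ) (r : ℝ) :
    Set (Matrix (Fin m) (Fin p) ℝ) :=
  {D | D ∈ obliqueManifold m p ∧ frobNorm (D - D₀) ≤ r}

/-- The law of a coefficient vector with support `S`: the entries are independent, those in `S`
have the law `N(0, σa²)`, and all the others vanish. -/
def coeffLawGiven {p : ℕ} (σa : ℝ) (S : Finset (Fin p)) : Measure (Fin p → ℝ) :=
  Measure.pi fun j => if j ∈ S then gaussianReal 0 (σa ^ 2).toNNReal else Measure.dirac 0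

/-- The law of the coefficient vector: the support is uniformly distributed over the
`p.choose s` subsets of size `s`, and given the support the law is `coeffLawGiven`. -/
def coeffLaw (p s : ℕ) (σa : ℝ) : Measure (Fin p → ℝ) :=
  ((p.choose s : ℕ) : ℝ≥0∞)⁻¹ •
    ∑ S ∈ Finset.powersetCard s (Finset.univ : Finset (Fin p)), coeffLawGiven σa S

/-- The law `N(0, σ² I)` of the noise vector. -/
def noiseLaw (m : ℕ) (σ : ℝ) : Measure (Fin m → ℝ) :=
  Measure.pi fun _ => gaussianReal 0 (σ ^ 2).toNNReal

/-- The law of one observation `y = D x + w`, with `x` and `w` independent. -/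
def obsLaw {m p : ℕ} (s : ℕ) (σa σ : ℝ) (D : Matrix (Fin m) (Fin p) ℝ) :
    Measure (Fin m → ℝ) :=
  ((coeffLaw p s σa).prod (noiseLaw m σ)).map fun z => D *ᵥ z.1 + z.2

/-- The law of the observations `Y = (y₁, …, y_N)`, which are independent copies of `y`. -/
def sampleLaw {m p : ℕ} (N s : ℕ) (σa σ : ℝ) (D : Matrix (Fin m) (Fin p) ℝ) :
    Measure (Fin N → Fin m → ℝ) :=
  Measure.pi fun _ => obsLaw s σa σ D

/-- The mean squared error `E_Y ‖Dhat(Y) - D‖_F²` of the learning scheme `Dhat` if the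
generating dictionary is `D`; its value is `∞` if the expectation is infinite. -/
def mse {m p : ℕ} (N s : ℕ) (σa σ : ℝ) (D : Matrix (Fin m) (Fin p) ℝ)
    (Dhat : (Fin N → Fin m → ℝ) → Matrix (Fin m) (Fin p) ℝ) : ℝ≥0∞ :=
  ∫⁻ Y, ENNReal.ofReal (frobNorm (Dhat Y - D) ^ 2) ∂(sampleLaw N s σa σ D)

/-- The minimax risk: the infimum over all (measurable) learning schemes of the largest mean
squared error over the dictionaries within distance `r` of `D₀`. -/
def minimaxRisk {m p : ℕ} (N s : ℕ) (σa σ : ℝ) (D₀ : Matrix (Fin m) (Fin p) ℝ) (r : ℝ) :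
    ℝ≥0∞ :=
  ⨅ (Dhat : (Fin N → Fin m → ℝ) → Matrix (Fin m) (Fin p) ℝ)
      (_ : ∀ i j, Measurable fun Y => Dhat Y i j),
    ⨆ D ∈ dictionaryBall D₀ r, mse N s σa σ D Dhat

/-- The signal to noise ratio `(σa / σ)²`. -/
def snr (σa σ : ℝ) : ℝ := (σa / σ) ^ 2

end DictLearning

end

/-! This is Assouad's method on a hypercube of dictionaries. For each column `d_j` of `D₀` choose a
unit vector `u_j` orthogonal to it; the `2 ^ p` vertices have columns `√(1 - t²) d_j ± t u_j`, and
all lie in the ball once `2pt² ≤ r²`. Vertices joined by an edge differ in one column only, by a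
vector of squared length `4t²`.

Conditionally on the coefficients `X`, the two samples of an edge are translates of the same
Gaussian matrix by `θ` and `θ'`, with `‖θ - θ'‖² = 4t² ∑ n, X n j ^ 2`. A pointwise inequality
between losses weighted by the two densities (`sq_add_le_tilted`, `two_translates_bound`) bounds the
sum of the two losses in column `j` from below, with an error linear in `‖θ - θ'‖²`. Averaging over
`X` therefore needs only `E x_j² = (s/p) σa²` (`two_dictionaries_bound`), and the loss sum is at
least `t²` if `2t² N (s/p) σa² ≤ σ²`.

Squared Frobenius loss is a sum over columns, so averaging over all edges gives risk at least
`pt²/2` (`hypercube_average`, `le_minimaxRisk`). The theorem takes the largest admissible `t²`. -/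

namespace DictLearning

/-! ### Densities of translated Gaussian noise. -/

section Shift

lemma pi_withDensity {ι : Type*} [Fintype ι] {X : ι → Type*} [∀ i, MeasurableSpace (X i)]
    (μ : ∀ i, Measure (X i)) [∀ i, IsProbabilityMeasure (μ i)] (f : ∀ i, X i → ℝ≥0∞)
    (hf : ∀ i, Measurable (f i)) [∀ i, SigmaFinite ((μ i).withDensity (f i))] :
    Measure.pi (fun i => (μ i).withDensity (f i)) =
      (Measure.pi μ).withDensity fun x => ∏ i, f i (x i) := by
  refine Measure.pi_eq fun t ht => ?_
  -- On a box the indicator factors over the coordinates, which are independent, so the integral of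
  -- the product density factors too.
  have hind : ∀ x : ∀ i, X i, (Set.univ.pi t).indicator (fun x => ∏ i, f i (x i)) x =
      ∏ i, (t i).indicator (f i) (x i) := by
    intro x
    by_cases hx : x ∈ Set.univ.pi t
    · rw [Set.indicator_of_mem hx]
      exact Finset.prod_congr rfl fun i _ => (Set.indicator_of_mem (hx i trivial) _).symm
    · rw [Set.indicator_of_notMem hx]
      simp only [Set.mem_pi, Set.mem_univ, true_implies, not_forall] at hx
      obtain ⟨i, hi⟩ := hx
      exact (Finset.prod_eq_zero (Finset.mem_univ i) (Set.indicator_of_notMem hi _)).symm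
  rw [withDensity_apply _ (MeasurableSet.univ_pi ht),
    ← lintegral_indicator (MeasurableSet.univ_pi ht)]
  simp_rw [hind]
  have hm : ∀ i, Measurable ((t i).indicator (f i)) := fun i => (hf i).indicator (ht i)
  rw [lintegral_prod_eq_prod_lintegral_of_indepFun Finset.univ
    (fun i (x : ∀ i, X i) => (t i).indicator (f i) (x i))
    (iIndepFun_pi fun i => (hm i).aemeasurable) fun i => (hm i).comp (measurable_pi_apply i)]
  refine Finset.prod_congr rfl fun i _ => ?_
  rw [withDensity_apply _ (ht i), ← lintegral_indicator (ht i),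
    ← (measurePreserving_eval μ i).lintegral_comp (hm i)]

/-- A translation of a product measure has the product of the densities of the translations of
the factors. -/
lemma pi_map_add_eq_withDensity {ι : Type*} [Fintype ι] {X : ι → Type*}
    [∀ i, MeasurableSpace (X i)] [∀ i, Add (X i)] [∀ i, MeasurableAdd (X i)]
    (μ : ∀ i, Measure (X i)) [∀ i, IsProbabilityMeasure (μ i)] (v : ∀ i, X i)
    (f : ∀ i, X i → ℝ≥0∞) (hf : ∀ i, Measurable (f i))
    (h : ∀ i, (μ i).map (fun x => v i + x) = (μ i).withDensity (f i)) :
    (Measure.pi μ).map (fun x => v + x) =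
      (Measure.pi μ).withDensity fun x => ∏ i, f i (x i) := by
  have hp : ∀ i, IsProbabilityMeasure ((μ i).map (fun x => v i + x)) := fun i =>
    Measure.isProbabilityMeasure_map (measurable_const_add (v i)).aemeasurable
  have hs : ∀ i, SigmaFinite ((μ i).withDensity (f i)) := fun i => by rw [← h i]; infer_instance
  rw [← pi_withDensity μ f hf]
  simp_rw [← h]
  exact Measure.pi_map_pi (f := fun i x => v i + x)
    fun i => (measurable_const_add (v i)).aemeasurable

lemma gaussianReal_map_add_eq_withDensity {σ : ℝ} (hσ : 0 < σ) (v : ℝ) :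
    (gaussianReal 0 (σ ^ 2).toNNReal).map (fun x => v + x) =
      (gaussianReal 0 (σ ^ 2).toNNReal).withDensity
        fun x => ENNReal.ofReal (Real.exp (v * x / σ ^ 2 - v ^ 2 / (2 * σ ^ 2))) := by
  have hne : (σ ^ 2).toNNReal ≠ 0 := by
    simpa using hσ.ne'
  rw [gaussianReal_map_const_add, gaussianReal_of_var_ne_zero _ hne,
    gaussianReal_of_var_ne_zero _ hne, ← withDensity_mul _ (measurable_gaussianPDF _ _)
    (by fun_prop)]
  congr 1
  ext x
  simp only [gaussianPDF, Pi.mul_apply, gaussianPDFReal]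
  rw [← ENNReal.ofReal_mul (by positivity), mul_assoc _ (Real.exp _), ← Real.exp_add]
  congr 3
  rw [Real.coe_toNNReal _ (by positivity)]
  field_simp
  ring

/-- The logarithm of the density of the noise matrix translated by `v`. -/
noncomputable def logShift {N m : ℕ} (σ : ℝ) (v W : Fin N → Fin m → ℝ) : ℝ :=
  ∑ n, ∑ i, (v n i * W n i / σ ^ 2 - v n i ^ 2 / (2 * σ ^ 2))

lemma measurable_logShift {N m : ℕ} (σ : ℝ) (v : Fin N → Fin m → ℝ) :
    Measurable (logShift σ v) := by
  unfold logShift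
  fun_prop

instance (m : ℕ) (σ : ℝ) : IsProbabilityMeasure (noiseLaw m σ) := by
  unfold noiseLaw; infer_instance

lemma noise_map_add {N m : ℕ} {σ : ℝ} (hσ : 0 < σ) (v : Fin N → Fin m → ℝ) :
    (Measure.pi fun _ : Fin N => noiseLaw m σ).map (fun W => v + W) =
      (Measure.pi fun _ : Fin N => noiseLaw m σ).withDensity
        fun W => ENNReal.ofReal (Real.exp (logShift σ v W)) := by
  have h1 : ∀ n, (noiseLaw m σ).map (fun x => v n + x) = _ := fun n =>
    pi_map_add_eq_withDensity (fun _ : Fin m => gaussianReal 0 (σ ^ 2).toNNReal) (v n)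
      (fun i x => ENNReal.ofReal (Real.exp (v n i * x / σ ^ 2 - v n i ^ 2 / (2 * σ ^ 2))))
      (fun i => by fun_prop) fun i => gaussianReal_map_add_eq_withDensity hσ (v n i)
  have h2 := pi_map_add_eq_withDensity (fun _ : Fin N => noiseLaw m σ) v _
    (fun n => by fun_prop) h1
  rw [h2]
  congr 1
  ext W
  simp only [logShift, Real.exp_sum]
  rw [ENNReal.ofReal_prod_of_nonneg fun n _ => by positivity]
  refine Finset.prod_congr rfl fun n _ => ?_
  rw [ENNReal.ofReal_prod_of_nonneg fun n _ => by positivity]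

lemma lintegral_noise_add {N m : ℕ} {σ : ℝ} (hσ : 0 < σ) (v : Fin N → Fin m → ℝ)
    {F : (Fin N → Fin m → ℝ) → ℝ≥0∞} (hF : Measurable F) :
    ∫⁻ W, F (v + W) ∂(Measure.pi fun _ : Fin N => noiseLaw m σ) =
      ∫⁻ W, ENNReal.ofReal (Real.exp (logShift σ v W)) * F W
        ∂(Measure.pi fun _ : Fin N => noiseLaw m σ) := by
  have hm : Measurable fun W => ENNReal.ofReal (Real.exp (logShift σ v W)) := by
    have := measurable_logShift σ v
    fun_prop
  rw [← lintegral_map hF (measurable_const_add v), noise_map_add hσ,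
    lintegral_withDensity_eq_lintegral_mul _ hm hF]
  rfl

end Shift

/-! ### Testing between two translates of the noise. -/

section TwoPoint

/-- With `c = E + E⁻¹`, Cauchy-Schwarz gives `(a + b)² ≤ c (E a² + E⁻¹ b²)`, and AM-GM gives `1 ≤
1/c + c/4`. Here `E` and `E⁻¹` play the role of the two densities, up to a common factor. -/
lemma sq_add_le_tilted (a b : ℝ) {E : ℝ} (hE : 0 < E) :
    (a + b) ^ 2 ≤ E * a ^ 2 + E⁻¹ * b ^ 2 + (E + E⁻¹) * ((a + b) ^ 2 / 4) := by
  have hc : 0 < E + E⁻¹ := by positivity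
  have hEi : E * E⁻¹ = 1 := mul_inv_cancel₀ hE.ne'
  have h1 : (a + b) ^ 2 ≤ (E * a ^ 2 + E⁻¹ * b ^ 2) * (E + E⁻¹) := by
    have h : (E * a ^ 2 + E⁻¹ * b ^ 2) * (E + E⁻¹) - (a + b) ^ 2 = (E * a - E⁻¹ * b) ^ 2 := by
      linear_combination (a ^ 2 + b ^ 2 + 2 * a * b) * hEi
    nlinarith [sq_nonneg (E * a - E⁻¹ * b)]
  have h2 : (a + b) ^ 2 / (E + E⁻¹) ≤ E * a ^ 2 + E⁻¹ * b ^ 2 := by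
    rwa [div_le_iff₀ hc]
  have h3 : (a + b) ^ 2 ≤ (a + b) ^ 2 / (E + E⁻¹) + (E + E⁻¹) * ((a + b) ^ 2 / 4) := by
    have h4 : 1 ≤ 1 / (E + E⁻¹) + (E + E⁻¹) / 4 := by
      rw [div_add_div _ _ hc.ne' (by norm_num), le_div_iff₀ (by positivity)]
      nlinarith [sq_nonneg (E + E⁻¹ - 2)]
    have := mul_le_mul_of_nonneg_left h4 (sq_nonneg (a + b))
    calc _ = (a + b) ^ 2 * 1 := by ring
      _ ≤ _ := this
      _ = _ := by ring
  linarith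

/-- Testing between two translates of the noise matrix: two losses that cannot both be small
cannot both have a small mean. -/
lemma two_translates_bound {N m : ℕ} {σ : ℝ} (hσ : 0 < σ) (θ θ' : Fin N → Fin m → ℝ)
    (x : (Fin N → Fin m → ℝ) → Fin m → ℝ) (hx : ∀ i, Measurable fun Y => x Y i)
    (d d' : Fin m → ℝ) :
    ENNReal.ofReal (∑ i, (d i - d' i) ^ 2) ≤
      ∫⁻ W, ENNReal.ofReal (∑ i, (x (θ + W) i - d i) ^ 2)
          ∂(Measure.pi fun _ : Fin N => noiseLaw m σ) +
        ∫⁻ W, ENNReal.ofReal (∑ i, (x (θ' + W) i - d' i) ^ 2)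
          ∂(Measure.pi fun _ : Fin N => noiseLaw m σ) +
        ENNReal.ofReal ((∑ i, (d i - d' i) ^ 2) / 2) +
        ENNReal.ofReal ((∑ i, (d i - d' i) ^ 2) *
          ((∑ n, ∑ i, (θ n i - θ' n i) ^ 2) / (8 * σ ^ 2))) := by
  set B : Measure (Fin N → Fin m → ℝ) := Measure.pi fun _ : Fin N => noiseLaw m σ with hB
  set Δ : ℝ := ∑ i, (d i - d' i) ^ 2 with hΔ
  have hΔ0 : 0 ≤ Δ := Finset.sum_nonneg fun i _ => sq_nonneg _
  -- Centring at the midpoint makes the translations `±v`, so the densities are `exp (±z - K)` with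
  -- the same `K = ‖v‖² / (2σ²) = ‖θ - θ'‖² / (8σ²)`.
  set c : Fin N → Fin m → ℝ := fun n i => (θ n i + θ' n i) / 2 with hc
  set v : Fin N → Fin m → ℝ := fun n i => (θ n i - θ' n i) / 2 with hv
  set K : ℝ := (∑ n, ∑ i, (θ n i - θ' n i) ^ 2) / (8 * σ ^ 2) with hK
  set z : (Fin N → Fin m → ℝ) → ℝ := fun W => ∑ n, ∑ i, v n i * W n i / σ ^ 2 with hz
  have hKv : K = ∑ n, ∑ i, v n i ^ 2 / (2 * σ ^ 2) := by
    simp only [hK, hv, Finset.sum_div]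
    refine Finset.sum_congr rfl fun n _ => Finset.sum_congr rfl fun i _ => ?_
    field_simp
    ring
  have hL : ∀ W, logShift σ v W = z W - K := by
    intro W
    simp only [logShift, Finset.sum_sub_distrib, hz, hKv]
  have hL' : ∀ W, logShift σ (-v) W = -z W - K := by
    intro W
    simp only [logShift, Finset.sum_sub_distrib, hz, hKv, Pi.neg_apply, neg_sq, neg_mul, neg_div,
      Finset.sum_neg_distrib]
  have hmθ : Measurable fun W => ENNReal.ofReal (∑ i, (x (c + W) i - d i) ^ 2) := by
    have : ∀ i, Measurable fun W => x (c + W) i := fun i =>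
      (hx i).comp (measurable_const_add c)
    fun_prop
  have hmθ' : Measurable fun W => ENNReal.ofReal (∑ i, (x (c + W) i - d' i) ^ 2) := by
    have : ∀ i, Measurable fun W => x (c + W) i := fun i =>
      (hx i).comp (measurable_const_add c)
    fun_prop
  have hcv : ∀ W, θ + W = c + (v + W) := by
    intro W; ext n i; simp only [Pi.add_apply, hc, hv]; ring
  have hcv' : ∀ W, θ' + W = c + (-v + W) := by
    intro W; ext n i; simp only [Pi.add_apply, Pi.neg_apply, hc, hv]; ring
  have hm1 : Measurable fun W => ENNReal.ofReal (Real.exp (logShift σ v W)) := by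
    have := measurable_logShift σ v
    fun_prop
  have hm2 : Measurable fun W => ENNReal.ofReal (Real.exp (logShift σ (-v) W)) := by
    have := measurable_logShift σ (-v)
    fun_prop
  have hone : ∀ w : Fin N → Fin m → ℝ,
      ∫⁻ W, ENNReal.ofReal (Real.exp (logShift σ w W)) ∂B = 1 := by
    intro w
    have := lintegral_noise_add hσ w (F := fun _ => 1) measurable_const
    simpa using this.symm
  have hm12 : Measurable fun W => ENNReal.ofReal (Real.exp (logShift σ v W)) +
      ENNReal.ofReal (Real.exp (logShift σ (-v) W)) := hm1.add hm2
  have hp1 : Measurable fun W => ENNReal.ofReal (Real.exp (logShift σ v W)) *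
      ENNReal.ofReal (∑ i, (x (c + W) i - d i) ^ 2) := hm1.mul hmθ
  have hp12 : Measurable fun W => ENNReal.ofReal (Real.exp (logShift σ v W)) *
      ENNReal.ofReal (∑ i, (x (c + W) i - d i) ^ 2) +
      ENNReal.ofReal (Real.exp (logShift σ (-v) W)) *
      ENNReal.ofReal (∑ i, (x (c + W) i - d' i) ^ 2) := hp1.add (hm2.mul hmθ')
  have key : ENNReal.ofReal (Δ * Real.exp (-K)) ≤
      ∫⁻ W, ENNReal.ofReal (∑ i, (x (θ + W) i - d i) ^ 2) ∂B +
        ∫⁻ W, ENNReal.ofReal (∑ i, (x (θ' + W) i - d' i) ^ 2) ∂B +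
        ENNReal.ofReal (Δ / 2) := by
    simp_rw [hcv, hcv']
    rw [lintegral_noise_add hσ v hmθ, lintegral_noise_add hσ (-v) hmθ']
    -- Both densities have integral one, so `Δ / 2` can be put under the integral as their sum times
    -- `Δ / 4`, the last term of the pointwise inequality.
    have hhalf : ENNReal.ofReal (Δ / 2) =
        ∫⁻ W, (ENNReal.ofReal (Real.exp (logShift σ v W)) +
          ENNReal.ofReal (Real.exp (logShift σ (-v) W))) * ENNReal.ofReal (Δ / 4) ∂B := by
      rw [lintegral_mul_const _ hm12, lintegral_add_left hm1, hone, hone,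
        show (1 : ℝ≥0∞) + 1 = ENNReal.ofReal 2 by norm_num, ← ENNReal.ofReal_mul (by norm_num)]
      congr 1; ring
    rw [hhalf, ← lintegral_add_left hp1, ← lintegral_add_left hp12]
    calc ENNReal.ofReal (Δ * Real.exp (-K))
        = ∫⁻ _, ENNReal.ofReal (Δ * Real.exp (-K)) ∂B := by simp [hB]
      _ ≤ _ := lintegral_mono fun W => ?_
    have hs1 : 0 ≤ ∑ i, (x (c + W) i - d i) ^ 2 := Finset.sum_nonneg fun i _ => sq_nonneg _
    have hs2 : 0 ≤ ∑ i, (x (c + W) i - d' i) ^ 2 := Finset.sum_nonneg fun i _ => sq_nonneg _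
    rw [← ENNReal.ofReal_mul (by positivity), ← ENNReal.ofReal_mul (by positivity),
      ← ENNReal.ofReal_add (by positivity) (by positivity),
      ← ENNReal.ofReal_add (by positivity) (by positivity),
      ← ENNReal.ofReal_mul (by positivity),
      ← ENNReal.ofReal_add (by positivity) (by positivity)]
    refine ENNReal.ofReal_le_ofReal ?_
    rw [hL, hL', sub_eq_add_neg, sub_eq_add_neg, Real.exp_add, Real.exp_add, Real.exp_neg (z W)]
    have hpt : Δ ≤ Real.exp (z W) * ∑ i, (x (c + W) i - d i) ^ 2 +
        (Real.exp (z W))⁻¹ * ∑ i, (x (c + W) i - d' i) ^ 2 +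
        (Real.exp (z W) + (Real.exp (z W))⁻¹) * (Δ / 4) := by
      rw [hΔ, Finset.sum_div, Finset.mul_sum, Finset.mul_sum, Finset.mul_sum,
        ← Finset.sum_add_distrib, ← Finset.sum_add_distrib]
      refine Finset.sum_le_sum fun i _ => ?_
      have := sq_add_le_tilted (x (c + W) i - d i) (d' i - x (c + W) i) (Real.exp_pos (z W))
      calc (d i - d' i) ^ 2
          = (x (c + W) i - d i + (d' i - x (c + W) i)) ^ 2 := by ring
        _ ≤ _ := this
        _ = _ := by ring
    have := mul_le_mul_of_nonneg_right hpt (Real.exp_pos (-K)).le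
    calc _ ≤ _ := this
      _ = _ := by ring
  have hK0 : 0 ≤ K := by
    rw [hK]; exact div_nonneg (Finset.sum_nonneg fun n _ => Finset.sum_nonneg fun i _ =>
      sq_nonneg _) (by positivity)
  -- The bound `1 ≤ exp (-K) + K` makes the error linear in `K`, hence quadratic in the
  -- translations.
  calc ENNReal.ofReal Δ ≤ ENNReal.ofReal (Δ * Real.exp (-K) + Δ * K) := by
        refine ENNReal.ofReal_le_ofReal ?_
        nlinarith [Real.add_one_le_exp (-K)]
    _ = ENNReal.ofReal (Δ * Real.exp (-K)) + ENNReal.ofReal (Δ * K) :=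
        ENNReal.ofReal_add (by positivity) (by positivity)
    _ ≤ _ := add_le_add_left key _

end TwoPoint

/-! ### Moments of the sparse coefficients, and conditioning on them. -/

section Laws

instance {p : ℕ} (σa : ℝ) (S : Finset (Fin p)) (j : Fin p) : IsProbabilityMeasure
    (if j ∈ S then gaussianReal 0 (σa ^ 2).toNNReal else Measure.dirac (0 : ℝ)) := by
  split_ifs <;> infer_instance

instance {p : ℕ} (σa : ℝ) (S : Finset (Fin p)) : IsProbabilityMeasure (coeffLawGiven σa S) := by
  unfold coeffLawGiven; infer_instance

lemma lintegral_coeffLaw (p s : ℕ) (σa : ℝ) (F : (Fin p → ℝ) → ℝ≥0∞) :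
    ∫⁻ x, F x ∂(coeffLaw p s σa) = ((p.choose s : ℕ) : ℝ≥0∞)⁻¹ *
      ∑ S ∈ Finset.powersetCard s (Finset.univ : Finset (Fin p)),
        ∫⁻ x, F x ∂(coeffLawGiven σa S) := by
  rw [coeffLaw, lintegral_smul_measure, lintegral_finsetSum_measure, smul_eq_mul]

lemma isProbabilityMeasure_coeffLaw {p s : ℕ} (hsp : s ≤ p) (σa : ℝ) :
    IsProbabilityMeasure (coeffLaw p s σa) := by
  refine ⟨?_⟩
  rw [← lintegral_one, lintegral_coeffLaw]
  simp only [lintegral_one, measure_univ, Finset.sum_const, Finset.card_powersetCard,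
    Finset.card_univ, Fintype.card_fin, nsmul_eq_mul, mul_one]
  exact ENNReal.inv_mul_cancel (by simpa using (Nat.choose_pos hsp).ne') (by simp)

lemma lintegral_sq_gaussianReal (σa : ℝ) :
    ∫⁻ x, ENNReal.ofReal (x ^ 2) ∂(gaussianReal 0 (σa ^ 2).toNNReal) =
      ENNReal.ofReal (σa ^ 2) := by
  have hi : Integrable (fun x : ℝ => x ^ 2) (gaussianReal 0 (σa ^ 2).toNNReal) :=
    (memLp_id_gaussianReal 2).integrable_sq
  rw [← ofReal_integral_eq_lintegral_ofReal hi (Filter.Eventually.of_forall fun x => sq_nonneg x)]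
  have h := variance_id_gaussianReal (μ := 0) (v := (σa ^ 2).toNNReal)
  rw [variance_eq_sub (memLp_id_gaussianReal 2)] at h
  simp only [id, Pi.pow_apply, integral_id_gaussianReal] at h
  have h' : ∫ x, x ^ 2 ∂(gaussianReal 0 (σa ^ 2).toNNReal) = σa ^ 2 := by
    have h0 := Real.coe_toNNReal (σa ^ 2) (sq_nonneg _)
    rw [h0] at h
    simpa using h
  rw [h']

lemma lintegral_sq_coeffLawGiven {p : ℕ} (σa : ℝ) (S : Finset (Fin p)) (j : Fin p) :
    ∫⁻ x, ENNReal.ofReal (x j ^ 2) ∂(coeffLawGiven σa S) =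
      if j ∈ S then ENNReal.ofReal (σa ^ 2) else 0 := by
  have hm : Measurable fun y : ℝ => ENNReal.ofReal (y ^ 2) := by fun_prop
  have := (measurePreserving_eval (fun j : Fin p => if j ∈ S then
    gaussianReal 0 (σa ^ 2).toNNReal else Measure.dirac (0 : ℝ)) j).lintegral_comp hm
  simp only [Function.eval] at this
  rw [coeffLawGiven, this]
  split_ifs
  · exact lintegral_sq_gaussianReal σa
  · simp

/-- Erasing `j` matches these sets with the subsets of size `s - 1` of the remaining `p - 1`
indices. The multiplied-out form avoids division; it says that `j` lies in the support with
probability `s / p`. -/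
lemma card_powersetCard_mem {p s : ℕ} (hs : 1 ≤ s) (j : Fin p) :
    ((Finset.powersetCard s (Finset.univ : Finset (Fin p))).filter (j ∈ ·)).card * p =
      p.choose s * s := by
  obtain ⟨k, rfl⟩ : ∃ k, s = k + 1 := ⟨s - 1, by omega⟩
  obtain ⟨q, rfl⟩ : ∃ q, p = q + 1 := ⟨p - 1, by have := j.2; omega⟩
  have h : ((Finset.powersetCard (k + 1) (Finset.univ : Finset (Fin (q + 1)))).filter
      (j ∈ ·)).card = q.choose k := by
    have hc := Finset.card_powersetCard k (Finset.univ.erase j)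
    rw [Finset.card_erase_of_mem (Finset.mem_univ j), Finset.card_univ, Fintype.card_fin,
      Nat.add_sub_cancel] at hc
    rw [← hc]
    refine Finset.card_bij' (fun S _ => S.erase j) (fun S _ => insert j S) ?_ ?_ ?_ ?_
    · intro S hS
      simp only [Finset.mem_filter, Finset.mem_powersetCard] at hS ⊢
      exact ⟨Finset.erase_subset_erase _ hS.1.1, by
        rw [Finset.card_erase_of_mem hS.2, hS.1.2, Nat.add_sub_cancel]⟩
    · intro S hS
      simp only [Finset.mem_filter, Finset.mem_powersetCard] at hS ⊢
      have hj : j ∉ S := fun h => by simpa using hS.1 h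
      exact ⟨⟨Finset.subset_univ _, by rw [Finset.card_insert_of_notMem hj, hS.2]⟩,
        Finset.mem_insert_self _ _⟩
    · intro S hS
      exact Finset.insert_erase (Finset.mem_filter.1 hS).2
    · intro S hS
      exact Finset.erase_insert fun h => by
        simpa using (Finset.mem_powersetCard.1 hS).1 h
  rw [h, mul_comm, Nat.add_one_mul_choose_eq]

lemma lintegral_sq_coeffLaw {p s : ℕ} (hs : 1 ≤ s) (hsp : s ≤ p) (σa : ℝ) (j : Fin p) :
    ∫⁻ x, ENNReal.ofReal (x j ^ 2) ∂(coeffLaw p s σa) =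
      ENNReal.ofReal (s / p * σa ^ 2) := by
  rw [lintegral_coeffLaw]
  simp_rw [lintegral_sq_coeffLawGiven]
  rw [← Finset.sum_filter, Finset.sum_const, nsmul_eq_mul]
  have hc := card_powersetCard_mem hs j
  set c := ((Finset.powersetCard s (Finset.univ : Finset (Fin p))).filter (j ∈ ·)).card
  have hch : (0 : ℝ) < p.choose s := by exact_mod_cast Nat.choose_pos hsp
  have hp : (0 : ℝ) < p := by exact_mod_cast (by omega : 0 < p)
  have hc' : (c : ℝ) * p = p.choose s * s := by exact_mod_cast hc
  rw [← ENNReal.ofReal_natCast (p.choose s), ← ENNReal.ofReal_inv_of_pos hch,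
    ← ENNReal.ofReal_natCast c, ← ENNReal.ofReal_mul (by positivity),
    ← ENNReal.ofReal_mul (by positivity)]
  congr 1
  field_simp
  linear_combination σa ^ 2 * hc'

/-- Conditioning on the coefficients: given `X`, the sample is the noise translated by the columns
`D *ᵥ X n`, so the two-translates bound applies. -/
lemma lintegral_sampleLaw {m p s N : ℕ} (hsp : s ≤ p) (σa σ : ℝ)
    (D : Matrix (Fin m) (Fin p) ℝ) {F : (Fin N → Fin m → ℝ) → ℝ≥0∞} (hF : Measurable F) :
    ∫⁻ Y, F Y ∂(sampleLaw N s σa σ D) =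
      ∫⁻ X, ∫⁻ W, F ((fun n => D *ᵥ X n) + W) ∂(Measure.pi fun _ : Fin N => noiseLaw m σ)
        ∂(Measure.pi fun _ : Fin N => coeffLaw p s σa) := by
  have := isProbabilityMeasure_coeffLaw hsp σa
  have hmul : Measurable fun x : Fin p → ℝ => D *ᵥ x := by
    refine measurable_pi_lambda _ fun i => ?_
    simp only [Matrix.mulVec, dotProduct]
    fun_prop
  have hf : Measurable fun z : (Fin p → ℝ) × (Fin m → ℝ) => D *ᵥ z.1 + z.2 :=
    (hmul.comp measurable_fst).add measurable_snd
  have hprob : IsProbabilityMeasure (((coeffLaw p s σa).prod (noiseLaw m σ)).map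
      fun z => D *ᵥ z.1 + z.2) := Measure.isProbabilityMeasure_map hf.aemeasurable
  have hf' : Measurable fun (x : Fin N → (Fin p → ℝ) × (Fin m → ℝ)) (n : Fin N) =>
      D *ᵥ (x n).1 + (x n).2 :=
    measurable_pi_lambda _ fun n => hf.comp (measurable_pi_apply n)
  have hg : Measurable fun q : (Fin N → Fin p → ℝ) × (Fin N → Fin m → ℝ) =>
      (fun n => D *ᵥ q.1 n) + q.2 := by
    refine Measurable.add (measurable_pi_lambda _ fun n => ?_) measurable_snd
    exact hmul.comp ((measurable_pi_apply n).comp measurable_fst)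
  unfold sampleLaw obsLaw
  rw [← Measure.pi_map_pi (μ := fun _ : Fin N => (coeffLaw p s σa).prod (noiseLaw m σ))
    (f := fun _ z => D *ᵥ z.1 + z.2) fun _ => hf.aemeasurable,
    lintegral_map hF hf']
  have hFg : Measurable fun q : (Fin N → Fin p → ℝ) × (Fin N → Fin m → ℝ) =>
      F ((fun n => D *ᵥ q.1 n) + q.2) := hF.comp hg
  exact ((measurePreserving_arrowProdEquivProdArrow (Fin p → ℝ) (Fin m → ℝ) (Fin N)
    (fun _ => coeffLaw p s σa) (fun _ => noiseLaw m σ)).lintegral_comp hFg).trans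
      (lintegral_prod _ hFg.aemeasurable)

/-- The two point bound: if two dictionaries differ only in one column, no scheme can estimate
that column well under both of them. -/
lemma two_dictionaries_bound {m p s N : ℕ} (hs : 1 ≤ s) (hsp : s ≤ p) {σ : ℝ} (σa : ℝ)
    (hσ : 0 < σ) (D D' : Matrix (Fin m) (Fin p) ℝ) (j : Fin p)
    (hDD' : ∀ i k, k ≠ j → D i k = D' i k)
    (Dhat : (Fin N → Fin m → ℝ) → Matrix (Fin m) (Fin p) ℝ)
    (hD : ∀ i k, Measurable fun Y => Dhat Y i k) :
    ENNReal.ofReal (∑ i, (D i j - D' i j) ^ 2) ≤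
      ∫⁻ Y, ENNReal.ofReal (∑ i, (Dhat Y i j - D i j) ^ 2) ∂(sampleLaw N s σa σ D) +
        ∫⁻ Y, ENNReal.ofReal (∑ i, (Dhat Y i j - D' i j) ^ 2) ∂(sampleLaw N s σa σ D') +
        ENNReal.ofReal ((∑ i, (D i j - D' i j) ^ 2) / 2) +
        ENNReal.ofReal ((∑ i, (D i j - D' i j) ^ 2) ^ 2 / (8 * σ ^ 2) *
          (N * (s / p * σa ^ 2))) := by
  have := isProbabilityMeasure_coeffLaw hsp σa
  set Δ : ℝ := ∑ i, (D i j - D' i j) ^ 2 with hΔ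
  have hm : ∀ E : Matrix (Fin m) (Fin p) ℝ,
      Measurable fun Y => ENNReal.ofReal (∑ i, (Dhat Y i j - E i j) ^ 2) := by
    intro E
    have := fun i => hD i j
    fun_prop
  have hadd : ∀ E : Matrix (Fin m) (Fin p) ℝ, Measurable
      fun q : (Fin N → Fin p → ℝ) × (Fin N → Fin m → ℝ) => (fun n => E *ᵥ q.1 n) + q.2 := by
    intro E
    refine Measurable.add (measurable_pi_lambda _ fun n => measurable_pi_lambda _ fun i => ?_)
      measurable_snd
    simp only [Matrix.mulVec, dotProduct]
    fun_prop
  have hmX : ∀ E : Matrix (Fin m) (Fin p) ℝ, Measurable fun X : Fin N → Fin p → ℝ =>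
      ∫⁻ W, ENNReal.ofReal (∑ i, (Dhat ((fun n => E *ᵥ X n) + W) i j - E i j) ^ 2)
        ∂(Measure.pi fun _ : Fin N => noiseLaw m σ) := fun E =>
    ((hm E).comp (hadd E)).lintegral_prod_right'
  -- Only column `j` differs, so only the coefficients `X n j` survive.
  have hsum : ∀ X : Fin N → Fin p → ℝ,
      ∑ n, ∑ i, ((D *ᵥ X n) i - (D' *ᵥ X n) i) ^ 2 = Δ * ∑ n, X n j ^ 2 := by
    intro X
    rw [Finset.mul_sum]
    refine Finset.sum_congr rfl fun n _ => ?_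
    rw [hΔ, Finset.sum_mul]
    refine Finset.sum_congr rfl fun i _ => ?_
    have : (D *ᵥ X n) i - (D' *ᵥ X n) i = (D i j - D' i j) * X n j := by
      simp only [Matrix.mulVec, dotProduct]
      rw [← Finset.sum_sub_distrib, Finset.sum_eq_single j]
      · ring
      · intro k _ hk
        rw [hDD' i k hk, sub_self]
      · simp
    rw [this]; ring
  have hmoment : ∫⁻ X : Fin N → Fin p → ℝ, ENNReal.ofReal
      (Δ * ((∑ n, ∑ i, ((D *ᵥ X n) i - (D' *ᵥ X n) i) ^ 2) / (8 * σ ^ 2)))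
        ∂(Measure.pi fun _ : Fin N => coeffLaw p s σa) =
      ENNReal.ofReal (Δ ^ 2 / (8 * σ ^ 2) * (N * (s / p * σa ^ 2))) := by
    simp_rw [hsum]
    have hre : ∀ X : Fin N → Fin p → ℝ,
        ENNReal.ofReal (Δ * (Δ * (∑ n, X n j ^ 2) / (8 * σ ^ 2))) =
          ENNReal.ofReal (Δ ^ 2 / (8 * σ ^ 2)) * ∑ n, ENNReal.ofReal (X n j ^ 2) := by
      intro X
      rw [← ENNReal.ofReal_sum_of_nonneg fun n _ => sq_nonneg _,
        ← ENNReal.ofReal_mul (by positivity)]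
      congr 1
      ring
    simp_rw [hre]
    have hmn : ∀ n : Fin N, Measurable fun X : Fin N → Fin p → ℝ =>
        ENNReal.ofReal (X n j ^ 2) := by
      intro n
      fun_prop
    rw [lintegral_const_mul _ (by fun_prop), lintegral_finsetSum _ fun n _ => hmn n]
    have hn : ∀ n : Fin N, ∫⁻ X : Fin N → Fin p → ℝ, ENNReal.ofReal (X n j ^ 2)
        ∂(Measure.pi fun _ : Fin N => coeffLaw p s σa) = ENNReal.ofReal (s / p * σa ^ 2) := by
      intro n
      rw [← lintegral_sq_coeffLaw hs hsp σa j]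
      exact (measurePreserving_eval (fun _ : Fin N => coeffLaw p s σa) n).lintegral_comp
        (f := fun x : Fin p → ℝ => ENNReal.ofReal (x j ^ 2)) (by fun_prop)
    simp_rw [hn]
    rw [Finset.sum_const, Finset.card_univ, Fintype.card_fin, nsmul_eq_mul,
      ← ENNReal.ofReal_natCast N, ← ENNReal.ofReal_mul (by positivity),
      ← ENNReal.ofReal_mul (by positivity)]
  rw [lintegral_sampleLaw hsp σa σ D (hm D), lintegral_sampleLaw hsp σa σ D' (hm D'), ← hmoment]
  have hhalf : ENNReal.ofReal (Δ / 2) = ∫⁻ _ : Fin N → Fin p → ℝ, ENNReal.ofReal (Δ / 2)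
      ∂(Measure.pi fun _ : Fin N => coeffLaw p s σa) := by simp
  have hm12 := (hmX D).add (hmX D')
  rw [hhalf, ← lintegral_add_left (hmX D), ← lintegral_add_left (by exact hm12),
    ← lintegral_add_left (by exact hm12.add_const _)]
  calc ENNReal.ofReal Δ = ∫⁻ _ : Fin N → Fin p → ℝ, ENNReal.ofReal Δ
        ∂(Measure.pi fun _ : Fin N => coeffLaw p s σa) := by simp
    _ ≤ _ := lintegral_mono fun X => ?_
  exact two_translates_bound hσ (fun n => D *ᵥ X n) (fun n => D' *ᵥ X n)
    (fun Y i => Dhat Y i j) (fun i => hD i j) (fun i => D i j) (fun i => D' i j)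

end Laws

/-! ### The hypercube of dictionaries and the averaging argument. -/

section Hypercube

lemma frobNorm_sq {m n : ℕ} (A : Matrix (Fin m) (Fin n) ℝ) :
    frobNorm A ^ 2 = ∑ j, ∑ i, A i j ^ 2 := by
  have h : (A * Aᵀ).trace = ∑ j, ∑ i, A i j ^ 2 := by
    simp only [Matrix.trace, Matrix.diag, Matrix.mul_apply, Matrix.transpose_apply]
    rw [Finset.sum_comm]
    simp only [sq]
  rw [frobNorm, h, Real.sq_sqrt (Finset.sum_nonneg fun j _ => Finset.sum_nonneg fun i _ =>
    sq_nonneg _)]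

lemma mem_obliqueManifold_iff {m p : ℕ} {B : Matrix (Fin m) (Fin p) ℝ} :
    B ∈ obliqueManifold m p ↔ ∀ j, ∑ i, B i j ^ 2 = 1 := by
  simp only [obliqueManifold, Set.mem_ofPred_eq, EuclideanSpace.norm_eq, Real.sqrt_eq_one]
  simp [Matrix.col]

lemma mse_eq_sum {m p N s : ℕ} (σa σ : ℝ) (D : Matrix (Fin m) (Fin p) ℝ)
    (Dhat : (Fin N → Fin m → ℝ) → Matrix (Fin m) (Fin p) ℝ)
    (hD : ∀ i k, Measurable fun Y => Dhat Y i k) :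
    mse N s σa σ D Dhat =
      ∑ j, ∫⁻ Y, ENNReal.ofReal (∑ i, (Dhat Y i j - D i j) ^ 2) ∂(sampleLaw N s σa σ D) := by
  unfold mse
  simp_rw [frobNorm_sq, Matrix.sub_apply]
  rw [← lintegral_finsetSum]
  · refine lintegral_congr fun Y => ?_
    exact ENNReal.ofReal_sum_of_nonneg fun j _ => Finset.sum_nonneg fun i _ => sq_nonneg _
  · intro j _
    have := fun i => hD i j
    fun_prop

/-- Averaging over the vertices of a hypercube: if in every direction the losses at the two ends
of each edge add up to at least `c`, then some vertex has total loss at least `p c / 2`. -/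
lemma hypercube_average {p : ℕ} (R : (Fin p → Bool) → Fin p → ℝ≥0∞) (c M : ℝ≥0∞)
    (hR : ∀ τ j, c ≤ R τ j + R (Function.update τ j (!τ j)) j)
    (hM : ∀ τ, ∑ j, R τ j ≤ M) : p * c ≤ 2 * M := by
  -- Flipping coordinate `j` permutes the vertices, so both ends of the edges contribute the same
  -- total.
  have hinv : ∀ j, ∑ τ, R (Function.update τ j (!τ j)) j = ∑ τ, R τ j := by
    intro j
    have hi : Function.Involutive fun τ : Fin p → Bool => Function.update τ j (!τ j) := by
      intro τ; simp
    exact Equiv.sum_comp (Function.Involutive.toPerm _ hi) fun τ => R τ j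
  have hcol : ∀ j, (2 : ℝ≥0∞) ^ p * c ≤ 2 * ∑ τ, R τ j := by
    intro j
    calc (2 : ℝ≥0∞) ^ p * c = ∑ _τ : Fin p → Bool, c := by simp
      _ ≤ ∑ τ, (R τ j + R (Function.update τ j (!τ j)) j) :=
          Finset.sum_le_sum fun τ _ => hR τ j
      _ = 2 * ∑ τ, R τ j := by rw [Finset.sum_add_distrib, hinv, two_mul]
  have h2 : (2 : ℝ≥0∞) ^ p * (p * c) ≤ 2 ^ p * (2 * M) :=
    calc (2 : ℝ≥0∞) ^ p * (p * c) = ∑ _j : Fin p, 2 ^ p * c := by simp; ring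
      _ ≤ ∑ j, 2 * ∑ τ, R τ j := Finset.sum_le_sum fun j _ => hcol j
      _ = 2 * ∑ τ, ∑ j, R τ j := by rw [← Finset.mul_sum, Finset.sum_comm]
      _ ≤ 2 * ∑ _τ : Fin p → Bool, M := by gcongr with τ; exact hM τ
      _ = 2 ^ p * (2 * M) := by simp; ring
  exact (ENNReal.mul_le_mul_iff_right (by simp) (by simp)).1 h2

/-- Two coordinates suffice: turn `(d x, d y)` by a right angle and normalise, or take a coordinate
vector if both entries vanish. -/
lemma exists_unit_orthogonal {m : ℕ} (hm : 2 ≤ m) (d : Fin m → ℝ) :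
    ∃ u : Fin m → ℝ, ∑ i, u i ^ 2 = 1 ∧ ∑ i, d i * u i = 0 := by
  set x : Fin m := ⟨0, by omega⟩
  set y : Fin m := ⟨1, by omega⟩
  have hxy : x ≠ y := by simp [x, y]
  obtain ⟨a, b, hab, h0⟩ : ∃ a b : ℝ, a ^ 2 + b ^ 2 = 1 ∧ d x * a + d y * b = 0 := by
    by_cases h : d x ^ 2 + d y ^ 2 = 0
    · have h1 : d x = 0 := by nlinarith [sq_nonneg (d x), sq_nonneg (d y)]
      have h2 : d y = 0 := by nlinarith [sq_nonneg (d x), sq_nonneg (d y)]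
      exact ⟨1, 0, by norm_num, by simp [h1, h2]⟩
    · have hpos : 0 < d x ^ 2 + d y ^ 2 := lt_of_le_of_ne (by positivity) (Ne.symm h)
      refine ⟨d y / √(d x ^ 2 + d y ^ 2), -d x / √(d x ^ 2 + d y ^ 2), ?_, by ring⟩
      rw [div_pow, div_pow, Real.sq_sqrt hpos.le, ← add_div, neg_sq, add_comm, div_self h]
  refine ⟨fun i => (if i = x then a else 0) + if i = y then b else 0, ?_, ?_⟩
  · have : ∀ i, ((if i = x then a else 0) + if i = y then b else 0) ^ 2 =
        (if i = x then a ^ 2 else 0) + if i = y then b ^ 2 else 0 := by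
      intro i
      by_cases h1 : i = x
      · have h2 : i ≠ y := h1 ▸ hxy
        simp [h1, hxy]
      · simp [h1]
    simp_rw [this, Finset.sum_add_distrib]
    simpa using hab
  · simp only [mul_add, mul_ite, mul_zero, Finset.sum_add_distrib]
    simpa using h0

/-- The vertices of a hypercube of dictionaries around `D₀`: the columns of `D₀` are rotated by
the angle `± arcsin t` towards the corresponding columns of `U`. -/
noncomputable def rotated {m p : ℕ} (D₀ U : Matrix (Fin m) (Fin p) ℝ) (t : ℝ) (τ : Fin p → Bool) :
    Matrix (Fin m) (Fin p) ℝ :=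
  fun i j => √(1 - t ^ 2) * D₀ i j + (if τ j then t else -t) * U i j

variable {m p : ℕ} {D₀ U : Matrix (Fin m) (Fin p) ℝ} {t : ℝ}

lemma sum_sq_combination (hD₀ : ∀ j, ∑ i, D₀ i j ^ 2 = 1) (hU : ∀ j, ∑ i, U i j ^ 2 = 1)
    (hDU : ∀ j, ∑ i, D₀ i j * U i j = 0) (a b : ℝ) (j : Fin p) :
    ∑ i, (a * D₀ i j + b * U i j) ^ 2 = a ^ 2 + b ^ 2 := by
  calc ∑ i, (a * D₀ i j + b * U i j) ^ 2
      = a ^ 2 * ∑ i, D₀ i j ^ 2 + 2 * a * b * ∑ i, D₀ i j * U i j + b ^ 2 * ∑ i, U i j ^ 2 := by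
        simp only [Finset.mul_sum, ← Finset.sum_add_distrib]
        exact Finset.sum_congr rfl fun i _ => by ring
    _ = a ^ 2 + b ^ 2 := by rw [hD₀, hU, hDU]; ring

lemma rotated_mem_dictionaryBall (hD₀ : ∀ j, ∑ i, D₀ i j ^ 2 = 1)
    (hU : ∀ j, ∑ i, U i j ^ 2 = 1) (hDU : ∀ j, ∑ i, D₀ i j * U i j = 0) {r : ℝ} (hr : 0 ≤ r)
    (ht : t ^ 2 ≤ 1) (htr : 2 * p * t ^ 2 ≤ r ^ 2) (τ : Fin p → Bool) :
    rotated D₀ U t τ ∈ dictionaryBall D₀ r := by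
  have hs := Real.sq_sqrt (sub_nonneg.2 ht)
  have hsq : ∀ j, (if τ j then t else -t) ^ 2 = t ^ 2 := by intro j; split_ifs <;> ring
  refine ⟨mem_obliqueManifold_iff.2 fun j => ?_, ?_⟩
  · rw [show ∑ i, rotated D₀ U t τ i j ^ 2 = _ from
      sum_sq_combination hD₀ hU hDU (√(1 - t ^ 2)) _ j, hs, hsq]
    ring
  · refine abs_le_of_sq_le_sq' ?_ hr |>.2
    rw [frobNorm_sq]
    have hj : ∀ j, ∑ i, (rotated D₀ U t τ - D₀) i j ^ 2 ≤ 2 * t ^ 2 := by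
      intro j
      have h1 : ∑ i, (rotated D₀ U t τ - D₀) i j ^ 2 = (√(1 - t ^ 2) - 1) ^ 2 + t ^ 2 := by
        rw [← hsq j, ← sum_sq_combination hD₀ hU hDU]
        refine Finset.sum_congr rfl fun i _ => ?_
        simp only [Matrix.sub_apply, rotated, hsq]
        ring
      -- The squared column distance is `2 - 2√(1 - t²)`, which this bounds by `2t²`.
      have h2 : 1 - t ^ 2 ≤ √(1 - t ^ 2) := by
        refine Real.le_sqrt_of_sq_le ?_
        nlinarith [sq_nonneg t]
      rw [h1]
      nlinarith
    calc _ ≤ ∑ _j : Fin p, 2 * t ^ 2 := Finset.sum_le_sum fun j _ => hj j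
      _ = 2 * p * t ^ 2 := by simp; ring
      _ ≤ r ^ 2 := htr

lemma sum_sq_rotated_sub_update (hU : ∀ j, ∑ i, U i j ^ 2 = 1) (τ : Fin p → Bool) (j : Fin p) :
    ∑ i, (rotated D₀ U t τ i j - rotated D₀ U t (Function.update τ j (!τ j)) i j) ^ 2 =
      4 * t ^ 2 := by
  have : ∀ i, (rotated D₀ U t τ i j - rotated D₀ U t (Function.update τ j (!τ j)) i j) ^ 2 =
      4 * t ^ 2 * U i j ^ 2 := by
    intro i
    simp only [rotated, Function.update_self]
    cases τ j <;> simp <;> ring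
  simp_rw [this]
  rw [← Finset.mul_sum, hU, mul_one]

/-- The risk is bounded below by the size of a hypercube whose neighbouring vertices cannot be
told apart. -/
lemma le_minimaxRisk {s N : ℕ} (hs : 1 ≤ s) (hsp : s ≤ p) {σa σ r : ℝ} (hσ : 0 < σ)
    (hm : 2 ≤ m) (hD₀ : D₀ ∈ obliqueManifold m p) (hr : 0 ≤ r) (ht : t ^ 2 ≤ 1)
    (htr : 2 * p * t ^ 2 ≤ r ^ 2) (htN : 2 * t ^ 2 * (N * (s / p * σa ^ 2)) ≤ σ ^ 2) :
    ENNReal.ofReal (p * t ^ 2 / 2) ≤ minimaxRisk N s σa σ D₀ r := by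
  rw [mem_obliqueManifold_iff] at hD₀
  choose u hu hdu using fun j : Fin p => exists_unit_orthogonal hm fun i => D₀ i j
  set U : Matrix (Fin m) (Fin p) ℝ := fun i j => u j i
  unfold minimaxRisk
  refine le_iInf₂ fun Dhat hD => ?_
  set M := ⨆ D ∈ dictionaryBall D₀ r, mse N s σa σ D Dhat with hM
  have hcube := hypercube_average (fun τ j => ∫⁻ Y, ENNReal.ofReal
      (∑ i, (Dhat Y i j - rotated D₀ U t τ i j) ^ 2) ∂(sampleLaw N s σa σ (rotated D₀ U t τ)))
    (ENNReal.ofReal (t ^ 2)) M ?_ ?_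
  · have h2 : ENNReal.ofReal (p * t ^ 2 / 2) * 2 = p * ENNReal.ofReal (t ^ 2) := by
      rw [← ENNReal.ofReal_natCast p, ← ENNReal.ofReal_mul (by positivity),
        show (2 : ℝ≥0∞) = ENNReal.ofReal 2 by norm_num, ← ENNReal.ofReal_mul (by positivity)]
      congr 1; ring
    rw [← h2, mul_comm] at hcube
    exact (ENNReal.mul_le_mul_iff_right (by simp) (by simp)).1 hcube
  · intro τ j
    have h := two_dictionaries_bound hs hsp σa hσ (rotated D₀ U t τ)
      (rotated D₀ U t (Function.update τ j (!τ j))) j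
      (fun i k hk => by simp [rotated, Function.update_of_ne hk]) Dhat hD
    rw [sum_sq_rotated_sub_update hu] at h
    -- With `Δ = 4t²` the error terms are `Δ / 2 = 2t²` and, by `htN`, at most `t²`. Cancelling the
    -- finite `3t²` leaves `t²` for the two losses.
    have hle : (4 * t ^ 2) ^ 2 / (8 * σ ^ 2) * (N * (s / p * σa ^ 2)) ≤ t ^ 2 := by
      rw [div_mul_eq_mul_div, div_le_iff₀ (by positivity)]
      nlinarith [mul_le_mul_of_nonneg_left htN (sq_nonneg t)]
    have h4 : ENNReal.ofReal (t ^ 2) + ENNReal.ofReal (3 * t ^ 2) =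
        ENNReal.ofReal (4 * t ^ 2) := by
      rw [← ENNReal.ofReal_add (by positivity) (by positivity)]
      congr 1; ring
    rw [add_assoc, ← ENNReal.ofReal_add (by positivity) (by positivity), ← h4] at h
    refine (ENNReal.add_le_add_iff_right (ENNReal.ofReal_ne_top (r := 3 * t ^ 2))).1
      (h.trans (add_le_add le_rfl (ENNReal.ofReal_le_ofReal ?_)))
    linarith
  · intro τ
    rw [← mse_eq_sum σa σ _ Dhat hD]
    exact le_iSup₂ (f := fun D _ => mse N s σa σ D Dhat) _
      (rotated_mem_dictionaryBall hD₀ hu hdu hr ht htr τ)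

end Hypercube

end DictLearning

theorem theorem1 (m p s N : ℕ) (σa σ r : ℝ) (hσa : 0 < σa) (hσ : 0 < σ)
    (hs : 1 ≤ s) (hsp : s ≤ p) (hN : 1 ≤ N)
    (D₀ : Matrix (Fin m) (Fin p) ℝ) (hD₀ : D₀ ∈ DictLearning.obliqueManifold m p)
    (hr : 0 < r) (hrp : r ≤ 1 / Real.sqrt p)
    (hp : 64 < p) (hm : 192 * (s : ℝ) * (9 + 2 * Real.log ((p : ℝ) / s)) ≤ m) :
    ENNReal.ofReal
        (min (r ^ 2 / 16)
          ((DictLearning.snr σa σ)⁻¹ * (p : ℝ) ^ 2 / (5120 * (N : ℝ) * (s : ℝ)))) ≤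
      DictLearning.minimaxRisk N s σa σ D₀ r := by
  have hs0 : (1 : ℝ) ≤ s := by exact_mod_cast hs
  have hN0 : (1 : ℝ) ≤ N := by exact_mod_cast hN
  have hp0 : (1 : ℝ) ≤ p := by exact_mod_cast (by omega : 1 ≤ p)
  have hm2 : 2 ≤ m := by
    have hlog : 0 ≤ Real.log ((p : ℝ) / s) :=
      Real.log_nonneg ((one_le_div (by linarith)).2 (by exact_mod_cast hsp))
    have : (2 : ℝ) ≤ m := by nlinarith
    exact_mod_cast this
  -- `q = t²` is the largest value satisfying both constraints of `le_minimaxRisk`, containment in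
  -- the ball and indistinguishability of neighbours. The resulting `pq/2` is the minimum of `r²/4`
  -- and `p² σ² / (4 N s σa²)`, which leaves room to spare in both constants.
  set q : ℝ := min (r ^ 2 / (2 * p)) (p * σ ^ 2 / (2 * N * s * σa ^ 2)) with hq
  have hq0 : 0 ≤ q := by positivity
  have hq1 : q ≤ r ^ 2 / (2 * p) := min_le_left _ _
  have hq2 : q ≤ p * σ ^ 2 / (2 * N * s * σa ^ 2) := min_le_right _ _
  have hqs : √q ^ 2 = q := Real.sq_sqrt hq0
  have hr1 : r ^ 2 ≤ 1 := by
    have h1 : (1 : ℝ) ≤ √p := Real.one_le_sqrt.2 hp0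
    have h2 : 1 / √(p : ℝ) ≤ 1 := (div_le_one (by linarith)).2 h1
    nlinarith
  rw [le_div_iff₀ (by positivity)] at hq1 hq2
  refine le_trans (ENNReal.ofReal_le_ofReal ?_)
    (DictLearning.le_minimaxRisk (t := √q) hs hsp hσ hm2 hD₀ hr.le ?_ ?_ ?_)
  · rw [hqs]
    rcases min_choice (r ^ 2 / (2 * p)) (p * σ ^ 2 / (2 * N * s * σa ^ 2)) with h | h
    · refine (min_le_left _ _).trans ?_
      rw [hq, h, show (p : ℝ) * (r ^ 2 / (2 * p)) / 2 = r ^ 2 / 4 by field_simp; norm_num]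
      nlinarith [sq_nonneg r]
    · refine (min_le_right _ _).trans ?_
      rw [hq, h, DictLearning.snr]
      have h1 : ((σa / σ) ^ 2)⁻¹ * (p : ℝ) ^ 2 / (5120 * N * s) =
          (σ ^ 2 * p ^ 2 / (N * s * σa ^ 2)) / 5120 := by field_simp
      have h2 : p * (p * σ ^ 2 / (2 * N * s * σa ^ 2)) / 2 =
          (σ ^ 2 * p ^ 2 / (N * s * σa ^ 2)) / 4 := by field_simp; norm_num
      rw [h1, h2]
      exact div_le_div_of_nonneg_left (by positivity) (by norm_num) (by norm_num)
  · rw [hqs]; nlinarith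
  · rw [hqs]; linarith
  · rw [hqs, show 2 * q * (N * (s / p * σa ^ 2)) = q * (2 * N * s * σa ^ 2) / p by ring,
      div_le_iff₀ (by linarith)]
    linarith
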